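/- Let $T>0$ and let $G\colon\mathbb R\times\mathbb R\to\mathcal P(\mathbb R)$ satisfy the following structural assumptions. (S1) $G(t,u)=-\mathcal A(t,u)+p(t,u)$, where - $\mathcal A$ is a set-valued map with nonempty values, $T$-periodic in $t$, maximal monotone increasing in $u$ for every $t$, measurable in $t$ for every $u$, and locally bounded in the sense that for every $r>0$ there is $m_r\in L^1_{\mathrm{loc}}(\mathbb R)$ with $|y|\le m_r(t)$ for almost every $t$, all $|u|\le r$ and all $y\in\mathcal A(t,u)$; - $p\colon\mathbb R\times\mathbb R\to\mathbb R$ is $T$-periodic and measurable in $t$, and locally Lipschitz continuous in $u$ uniformly in $t$. (S2) There are $R>0$ and $T$-periodic functions $\ell_d^{\pm}\colon\mathbb R\to\mathbb R$, integrable on $(0,T)$, with $\int_0^T\ell_d^\pm(s)\,ds<0$, such that for almost every $t$: $y\ge-\ell_d^-(t)$ for all $u\le-R$, $y\in G(t,u)$, and $y\le\ell_d^+(t)$ for all $u\ge R$, $y\in G(t,u)$. Suppose moreover that for every $t$ the map $G(t,\cdot)$ is monotone decreasing, i.e. $(y_2-y_1)(u_2-u_1)\le0$ for all $u_1\ne u_2$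 and $y_i\in G(t,u_i)$. A solution of $\dot v\in G(t,v)$ on an interval is a function that is absolutely continuous on compact subintervals and satisfies the inclusion at almost every $t$. Then for every $x_0\in\mathbb R$ there is a solution on $[0,T]$ with value $x_0$ at $t=0$, and it is unique on $[0,T]$; let $\Phi_T(x_0)$ be its value at $t=T$ (the Poincaré map). Put $v_-=-R-\|\ell_d^-\|_{L^1(0,T)}$, $v_+=R+\|\ell_d^+\|_{L^1(0,T)}$ and $K=\bigcap_{i\in\mathbb N}\Phi_T^i([v_-,v_+])$. Then: 1. $K=[\alpha,\beta]$ for some real $\alpha\le\beta$, and $K$ is a global attractor for $v_{n+1}=\Phi_T(v_n)$: it is nonempty and compact, $\Phi_T(K)=K$, and $\sup_{x\in B}\operatorname{dist}(\Phi_T^n(x),K)\to0$ as $n\to\infty$ for every nonempty bounded $B\subset\mathbb R$. Moreover $\Phi_T(\alpha)=\alpha$, $\Phi_T(\beta)=\beta$, and for every $v_0\in\mathbb R$ the sequence $\Phi_T^i(v_0)$ converges to some $v^*\in[\alpha,\beta]$ with $\Phi_T(v^*)=v^*$. 2. $K$ is exactly the set of fixed points of $\Phi_T$, and for each $\gamma\in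 K$ there is exactly one $T$-periodic solution $v\colon\mathbb R\to\mathbb R$ of $\dot v\in G(t,v)$ with $v(0)=\gamma$. 3. If $v_\alpha$ denotes the $T$-periodic solution with $v_\alpha(0)=\alpha$, then a function is a $T$-periodic solution of $\dot v\in G(t,v)$ if and only if it is of the form $t\mapsto v_\alpha(t)+(\gamma-\alpha)$ with $\gamma\in[\alpha,\beta]$. -/

import Mathlib

namespace PeriodicInclusion

open MeasureTheory Set Filter Topology

/-- The set-valued map `F : ℝ → 𝒫(ℝ)` is monotone increasing. -/
def MonotoneIncreasing (F : ℝ → Set ℝ) : Prop :=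
  ∀ u₁ u₂ : ℝ, u₁ ≠ u₂ → ∀ y₁ ∈ F u₁, ∀ y₂ ∈ F u₂, 0 ≤ (y₂ - y₁) * (u₂ - u₁)

/-- The set-valued map `F : ℝ → 𝒫(ℝ)` is monotone decreasing. -/
def MonotoneDecreasing (F : ℝ → Set ℝ) : Prop :=
  ∀ u₁ u₂ : ℝ, u₁ ≠ u₂ → ∀ y₁ ∈ F u₁, ∀ y₂ ∈ F u₂, (y₂ - y₁) * (u₂ - u₁) ≤ 0

/-- The graph of a set-valued map. -/
def graph (F : ℝ → Set ℝ) : Set (ℝ × ℝ) := {z | z.2 ∈ F z.1}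

/-- `F` is monotone increasing, and no monotone increasing map has a strictly larger graph. -/
def MaximalMonotoneIncreasing (F : ℝ → Set ℝ) : Prop :=
  MonotoneIncreasing F ∧ ¬ ∃ F' : ℝ → Set ℝ, MonotoneIncreasing F' ∧ graph F ⊂ graph F'

/-- `F : ℝ → 𝒫(ℝ)` is (Lebesgue) measurable: preimages of open sets are Lebesgue measurable. -/
def SetValuedMeasurable (F : ℝ → Set ℝ) : Prop :=
  ∀ U : Set ℝ, IsOpen U → NullMeasurableSet {t | (F t ∩ U).Nonempty} volume

/-- Assumptions on the maximal monotone part. The last field says that `A` is locally bounded: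
on every bounded set of values of `u` it is bounded by a locally integrable function of `t`. -/
structure MonotonePart (T : ℝ) (A : ℝ → ℝ → Set ℝ) : Prop where
  nonempty : ∀ t u, (A t u).Nonempty
  periodic : ∀ t u, A (t + T) u = A t u
  maximal : ∀ t, MaximalMonotoneIncreasing (A t)
  measurable : ∀ u, SetValuedMeasurable (fun t => A t u)
  bounded : ∀ r : ℝ, ∃ m : ℝ → ℝ, LocallyIntegrable m volume ∧
    ∀ᵐ t, ∀ u ∈ Icc (-r) r, ∀ y ∈ A t u, |y| ≤ m t

/-- Assumptions on the single-valued part: (Lebesgue) measurable in `t`, periodic, and locally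
Lipschitz continuous in `u` uniformly in `t` (so in particular continuous in `u`). -/
structure LipschitzPart (T : ℝ) (p : ℝ → ℝ → ℝ) : Prop where
  measurable : ∀ u, AEMeasurable (fun t => p t u) volume
  periodic : ∀ t u, p (t + T) u = p t u
  lipschitz : ∀ r : ℝ, ∃ L : NNReal, ∀ t, LipschitzOnWith L (p t) (Icc (-r) r)

/-- First structural assumption: `G(t,u) = -A(t,u) + p(t,u)`. -/
def StructuralForm (T : ℝ) (G : ℝ → ℝ → Set ℝ) : Prop :=
  ∃ (A : ℝ → ℝ → Set ℝ) (p : ℝ → ℝ → ℝ), MonotonePart T A ∧ LipschitzPart T p ∧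
    ∀ t u, G t u = {y | ∃ a ∈ A t u, y = -a + p t u}

/-- Second structural assumption, with the constant `R` and the functions `ℓ_d^-`, `ℓ_d^+`. -/
structure Dissipative (T : ℝ) (G : ℝ → ℝ → Set ℝ) (R : ℝ) (lm lp : ℝ → ℝ) : Prop where
  R_pos : 0 < R
  lm_periodic : Function.Periodic lm T
  lp_periodic : Function.Periodic lp T
  lm_integrable : IntervalIntegrable lm volume 0 T
  lp_integrable : IntervalIntegrable lp volume 0 T
  lm_neg : ∫ s in (0 : ℝ)..T, lm s < 0
  lp_neg : ∫ s in (0 : ℝ)..T, lp s < 0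
  lower : ∀ᵐ t, ∀ u ∈ Iic (-R), ∀ y ∈ G t u, -lm t ≤ y
  upper : ∀ᵐ t, ∀ u ∈ Ici R, ∀ y ∈ G t u, y ≤ lp t

/-- `u` is a solution of `u' ∈ G(t,u)` on the interval `I`: it is absolutely continuous on every
compact subinterval of `I`, and at almost every `t ∈ I` it has a derivative lying in
`G(t,u(t))`. -/
def IsSolutionOn (G : ℝ → ℝ → Set ℝ) (u : ℝ → ℝ) (I : Set ℝ) : Prop :=
  (∀ a b, a ≤ b → Icc a b ⊆ I → AbsolutelyContinuousOnInterval u a b) ∧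
    ∀ᵐ t, t ∈ I → ∃ y ∈ G t (u t), HasDerivAt u y t

/-- `v` is a `T`-periodic solution, defined on all of `ℝ`. -/
def IsPeriodicSolution (T : ℝ) (G : ℝ → ℝ → Set ℝ) (v : ℝ → ℝ) : Prop :=
  Function.Periodic v T ∧ IsSolutionOn G v univ

/-- `Φ` is the Poincaré map `Φ_T` of `u' ∈ G(t,u)`: for every `x₀` the Cauchy problem `u(0) = x₀`
has a solution on `[0,T]`, any two such solutions agree on `[0,T]`, and `Φ x₀` is the value at
time `T`. There is at most one such `Φ`; its existence is a matter of well-posedness. -/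
def IsPoincareMap (T : ℝ) (G : ℝ → ℝ → Set ℝ) (Φ : ℝ → ℝ) : Prop :=
  ∀ x₀ : ℝ, ∃ u : ℝ → ℝ, IsSolutionOn G u (Icc 0 T) ∧ u 0 = x₀ ∧ u T = Φ x₀ ∧
    ∀ w : ℝ → ℝ, IsSolutionOn G w (Icc 0 T) → w 0 = x₀ → EqOn w u (Icc 0 T)

/-- `v_- = -R - ‖ℓ_d^-‖_{L¹(0,T)}`. -/
noncomputable def vMinus (T R : ℝ) (lm : ℝ → ℝ) : ℝ := -R - ∫ s in (0 : ℝ)..T, |lm s|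

/-- `v_+ = R + ‖ℓ_d^+‖_{L¹(0,T)}`. -/
noncomputable def vPlus (T R : ℝ) (lp : ℝ → ℝ) : ℝ := R + ∫ s in (0 : ℝ)..T, |lp s|

/-- `K = ⋂ᵢ Φⁱ([v_-,v_+])`. -/
noncomputable def attractorSet (Φ : ℝ → ℝ) (T R : ℝ) (lm lp : ℝ → ℝ) : Set ℝ :=
  ⋂ i : ℕ, Φ^[i] '' Icc (vMinus T R lm) (vPlus T R lp)

/-- `K` is a global attractor of the discrete dynamics `v_{n+1} = Φ(v_n)`: a nonempty compact
invariant set which attracts every bounded set uniformly. -/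
def IsGlobalAttractor (Φ : ℝ → ℝ) (K : Set ℝ) : Prop :=
  K.Nonempty ∧ IsCompact K ∧ Φ '' K = K ∧
    ∀ B : Set ℝ, Bornology.IsBounded B → ∀ ε > 0,
      ∀ᶠ n : ℕ in atTop, ∀ x ∈ B, Metric.infDist (Φ^[n] x) K < ε

end PeriodicInclusion

open PeriodicInclusion

namespace PeriodicInclusion

open MeasureTheory Set Filter Topology

/-! ### Monotone nonexpansive maps of the line with an absorbing interval -/

section Dynamics

variable {Φ : ℝ → ℝ} {a b c c' : ℝ}

/-! Since `G t` is decreasing, `(u - w) ^ 2` has nonpositive derivative for two solutions, so their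
distance never grows (`IsSolutionOn.antitoneOn_abs_sub`). This gives uniqueness, preservation of
order, and a monotone nonexpansive Poincaré map. By dissipativity, over one period a solution either
ends below `vPlus` or drops by at least `-∫ lp > 0`, and symmetrically from below
(`le_add_integral_of_deriv_le`). The rest of the dynamics is one-dimensional
(`dynamics_of_absorbing`): orbits are monotone and bounded, hence converge to fixed points; `α` and
`β` are the limits of the orbits of the endpoints, and nonexpansiveness fixes everything between two
fixed points. For periodic solutions the distance is both nonincreasing and periodic, hence
constant, which makes them vertical translates of each other. Existence does not use that `G t` is
decreasing. Euler polygons for a measurable selection of a truncated problem converge along a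
subsequence; closed graph and convex values put the derivative of the limit in the right-hand side
(`exists_isSolutionOn_of_dominated`), and an a priori bound makes the truncation inactive. -/

lemma abs_iterate_sub_le (hlip : ∀ x y, |Φ x - Φ y| ≤ |x - y|) (n : ℕ) (x y : ℝ) :
    |Φ^[n] x - Φ^[n] y| ≤ |x - y| := by
  induction n generalizing x y with
  | zero => simp
  | succ n ih => exact (ih (Φ x) (Φ y)).trans (hlip x y)

lemma continuous_of_nonexpansive (hlip : ∀ x y, |Φ x - Φ y| ≤ |x - y|) : Continuous Φ :=
  (LipschitzWith.of_dist_le_mul (K := 1) fun x y => by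
    simpa [Real.dist_eq] using hlip x y).continuous

/-- If `Φ` is monotone and nonexpansive with a fixed point, all orbits converge to fixed points. -/
lemma exists_tendsto_iterate (hmon : Monotone Φ) (hlip : ∀ x y, |Φ x - Φ y| ≤ |x - y|)
    {z : ℝ} (hz : Φ z = z) (x : ℝ) :
    ∃ y, Φ y = y ∧ Tendsto (fun n : ℕ => Φ^[n] x) atTop (𝓝 y) := by
  have hbd (n : ℕ) : |Φ^[n] x - z| ≤ |x - z| := by
    simpa [Function.iterate_fixed hz n] using abs_iterate_sub_le hlip n x z
  have key : ∃ y, Tendsto (fun n : ℕ => Φ^[n] x) atTop (𝓝 y) := by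
    rcases le_total (Φ x) x with h | h
    · refine ⟨_, tendsto_atTop_ciInf (hmon.antitone_iterate_of_map_le h) ⟨z - |x - z|, ?_⟩⟩
      rintro _ ⟨n, rfl⟩
      have := abs_le.1 (hbd n)
      dsimp only
      linarith
    · refine ⟨_, tendsto_atTop_ciSup (hmon.monotone_iterate_of_le_map h) ⟨z + |x - z|, ?_⟩⟩
      rintro _ ⟨n, rfl⟩
      have := abs_le.1 (hbd n)
      dsimp only
      linarith
  obtain ⟨y, hy⟩ := key
  exact ⟨y, isFixedPt_of_tendsto_iterate hy (continuous_of_nonexpansive hlip).continuousAt, hy⟩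

lemma exists_fixedPt_of_mapsTo_Icc (hlip : ∀ x y, |Φ x - Φ y| ≤ |x - y|) (hab : a ≤ b)
    (ha : a ≤ Φ a) (hb : Φ b ≤ b) : ∃ z, Φ z = z := by
  obtain ⟨z, -, hz⟩ := exists_mem_Icc_isFixedPt
    (continuous_of_nonexpansive hlip).continuousOn hab ha hb
  exact ⟨z, hz⟩

/-- The intersection of the iterated images of an absorbing interval is a compact interval, it is
the set of fixed points and the global attractor. -/
lemma dynamics_of_absorbing (hmon : Monotone Φ) (hlip : ∀ x y, |Φ x - Φ y| ≤ |x - y|)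
    (hab : a ≤ b) (hc : 0 < c) (hc' : 0 < c') (hup : ∀ x, Φ x ≤ max b (x - c))
    (hlow : ∀ x, min a (x + c') ≤ Φ x) :
    ∃ α β : ℝ, α ≤ β ∧ (⋂ i : ℕ, Φ^[i] '' Icc a b) = Icc α β ∧
      IsGlobalAttractor Φ (Icc α β) ∧ Φ α = α ∧ Φ β = β ∧
      (∀ v₀ : ℝ, ∃ vlim ∈ Icc α β, Φ vlim = vlim ∧
        Tendsto (fun i : ℕ => Φ^[i] v₀) atTop (𝓝 vlim)) ∧
      Icc α β = {x | Φ x = x} := by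
  -- A fixed point above `b` would satisfy `x ≤ x - c`, and one below `a` would satisfy `x + c' ≤
  -- x`.
  have hfix_mem {x : ℝ} (hx : Φ x = x) : x ∈ Icc a b := by
    have h1 := hup x
    have h2 := hlow x
    rw [hx] at h1 h2
    constructor
    · rcases min_le_iff.1 h2 with h | h <;> linarith
    · rcases le_max_iff.1 h1 with h | h <;> linarith
  have ha : a ≤ Φ a := by simpa [hc'.le] using hlow a
  have hb : Φ b ≤ b := by simpa [hc.le] using hup b
  obtain ⟨z, hz⟩ := exists_fixedPt_of_mapsTo_Icc hlip hab ha hb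
  obtain ⟨α, hα, hαlim⟩ := exists_tendsto_iterate hmon hlip hz a
  obtain ⟨β, hβ, hβlim⟩ := exists_tendsto_iterate hmon hlip hz b
  have hαβ : α ≤ β := le_of_tendsto_of_tendsto' hαlim hβlim fun n => hmon.iterate n hab
  -- `Φ x` is no farther than `x` from either of the fixed points `α` and `β`, which leaves only
  -- `x`.
  have hIcc_fix : Icc α β ⊆ {x | Φ x = x} := by
    intro x hx
    have h1 := hlip x α
    have h2 := hlip β x
    rw [hα, abs_of_nonneg (sub_nonneg.2 hx.1)] at h1
    rw [hβ, abs_of_nonneg (sub_nonneg.2 hx.2)] at h2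
    have h3 := (abs_le.1 h1).2
    have h4 := (abs_le.1 h2).2
    exact le_antisymm (by linarith) (by linarith)
  have hfix_inter : {x | Φ x = x} ⊆ ⋂ i : ℕ, Φ^[i] '' Icc a b := by
    intro x hx
    exact mem_iInter.2 fun i => ⟨x, hfix_mem hx, Function.iterate_fixed hx i⟩
  have hinter : (⋂ i : ℕ, Φ^[i] '' Icc a b) ⊆ Icc α β := by
    intro x hx
    rw [mem_iInter] at hx
    refine ⟨le_of_tendsto' hαlim fun n => ?_, ge_of_tendsto' hβlim fun n => ?_⟩
    · obtain ⟨y, hy, rfl⟩ := hx n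
      exact hmon.iterate n hy.1
    · obtain ⟨y, hy, rfl⟩ := hx n
      exact hmon.iterate n hy.2
  have hfix : Icc α β = {x | Φ x = x} :=
    hIcc_fix.antisymm (hfix_inter.trans hinter)
  have hlim (v₀ : ℝ) : ∃ vlim ∈ Icc α β, Φ vlim = vlim ∧
      Tendsto (fun i : ℕ => Φ^[i] v₀) atTop (𝓝 vlim) := by
    obtain ⟨y, hy, hlim⟩ := exists_tendsto_iterate hmon hlip hz v₀
    exact ⟨y, hfix ▸ hy, hy, hlim⟩
  refine ⟨α, β, hαβ, hinter.antisymm (hIcc_fix.trans hfix_inter),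
    ⟨nonempty_Icc.2 hαβ, isCompact_Icc, ?_, ?_⟩, hα, hβ, hlim, hfix⟩
  · refine Subset.antisymm ?_ fun x hx => ⟨x, hx, hIcc_fix hx⟩
    rintro _ ⟨x, hx, rfl⟩
    rwa [hIcc_fix hx]
  · intro B hB ε hε
    -- Attraction is uniform on `B` because all its orbits lie between those of `-r` and `r`, whose
    -- limits are in `[α, β]`.
    obtain ⟨r, hr⟩ := hB.subset_closedBall 0
    obtain ⟨y, hy, -, hylim⟩ := hlim (-r)
    obtain ⟨z, hz, -, hzlim⟩ := hlim r
    filter_upwards [hylim.eventually (lt_mem_nhds (show y - ε < y by linarith)),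
      hzlim.eventually (gt_mem_nhds (show z < z + ε by linarith))] with n h1 h2 x hx
    have hxr : |x| ≤ r := by simpa using hr hx
    have h3 := hmon.iterate n (neg_le_of_abs_le hxr)
    have h4 := hmon.iterate n (le_of_abs_le hxr)
    have hproj : max α (min β (Φ^[n] x)) ∈ Icc α β :=
      ⟨le_max_left _ _, max_le hαβ (min_le_left _ _)⟩
    refine (Metric.infDist_le_dist_of_mem hproj).trans_lt ?_
    rw [Real.dist_eq, abs_lt]
    have := hy.1
    have := hz.2
    rcases le_total β (Φ^[n] x) with h | h
    · rw [min_eq_left h, max_eq_right hαβ]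
      constructor <;> linarith
    · rw [min_eq_right h]
      rcases le_total α (Φ^[n] x) with h' | h'
      · rw [max_eq_right h']
        constructor <;> linarith
      · rw [max_eq_left h']
        constructor <;> linarith

end Dynamics

/-! ### Absolutely continuous functions -/

section AbsolutelyContinuous

/-- Used with `g` a primitive of an integrable function, for the limit of the polygons and for the
periodic extension. -/
lemma absolutelyContinuousOnInterval_of_dist_le {f g : ℝ → ℝ} {a b : ℝ}
    (hg : AbsolutelyContinuousOnInterval g a b)
    (h : ∀ s ∈ uIcc a b, ∀ t ∈ uIcc a b, dist (f s) (f t) ≤ dist (g s) (g t)) :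
    AbsolutelyContinuousOnInterval f a b := by
  refine squeeze_zero' (Eventually.of_forall fun E => Finset.sum_nonneg fun _ _ => dist_nonneg)
    ?_ hg
  refine Eventually.filter_mono inf_le_right ?_
  filter_upwards [mem_principal_self _] with E hE
  exact Finset.sum_le_sum fun i hi => h _ (hE.1 i hi).1 _ (hE.1 i hi).2

lemma sub_le_integral_of_deriv_le {u l : ℝ → ℝ} {a b : ℝ} (hab : a ≤ b)
    (hu : AbsolutelyContinuousOnInterval u a b) (hl : IntervalIntegrable l volume a b)
    (h : ∀ᵐ t, t ∈ Icc a b → deriv u t ≤ l t) : u b - u a ≤ ∫ t in a..b, l t := by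
  rw [← hu.integral_deriv_eq_sub]
  refine intervalIntegral.integral_mono_ae_restrict hab hu.intervalIntegrable_deriv hl ?_
  exact (ae_restrict_iff' measurableSet_Icc).2 h

/-- If `u' ≤ l` wherever `u ≥ R`, then either `u` gets below `R`, and ends not far above `R`, or
the increment of `u` is bounded by the integral of `l`. -/
lemma le_add_integral_of_deriv_le {u l : ℝ → ℝ} {a b R : ℝ} (hab : a ≤ b)
    (hu : AbsolutelyContinuousOnInterval u a b) (hl : IntervalIntegrable l volume a b)
    (h : ∀ᵐ t, t ∈ Icc a b → R ≤ u t → deriv u t ≤ l t) :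
    u b ≤ R + ∫ t in a..b, |l t| ∨ u b ≤ u a + ∫ t in a..b, l t := by
  have hcont : ContinuousOn u (Icc a b) := by simpa [uIcc_of_le hab] using hu.continuousOn
  by_cases hR : ∀ t ∈ Icc a b, R ≤ u t
  · right
    have := sub_le_integral_of_deriv_le hab hu hl
      (h.mono fun t ht ht' => ht ht' (hR t ht'))
    linarith
  left
  push Not at hR
  obtain ⟨t₀, ht₀, hut₀⟩ := hR
  have hcomp : IsCompact {t ∈ Icc a b | u t ≤ R} :=
    isCompact_Icc.of_isClosed_subset (hcont.preimage_isClosed_of_isClosed isClosed_Icc isClosed_Iic)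
      (sep_subset _ _)
  -- `s` is the last time with `u s ≤ R`. The derivative bound holds a.e. after it, and the single
  -- time `s` is discarded as a null set.
  obtain ⟨s, ⟨hs, hus⟩, hmax⟩ := hcomp.exists_isGreatest ⟨t₀, ht₀, hut₀.le⟩
  have hsub : uIcc s b ⊆ uIcc a b := by
    rw [uIcc_of_le hs.2, uIcc_of_le hab]
    exact Icc_subset_Icc_left hs.1
  have hl' : IntervalIntegrable l volume s b := hl.mono_set hsub
  have h1 : u b - u s ≤ ∫ t in s..b, l t := by
    refine sub_le_integral_of_deriv_le hs.2 (hu.mono hsub) hl' ?_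
    have hne : ∀ᵐ t : ℝ, t ≠ s := by simp [ae_iff, measure_singleton]
    filter_upwards [h, hne] with t ht hts htb
    have htab : t ∈ Icc a b := ⟨hs.1.trans htb.1, htb.2⟩
    refine ht htab ?_
    by_contra hlt
    exact hts (le_antisymm (hmax ⟨htab, (not_le.1 hlt).le⟩) htb.1)
  have h2 : ∫ t in s..b, l t ≤ ∫ t in s..b, |l t| :=
    intervalIntegral.integral_mono hs.2 hl' hl'.abs fun t => le_abs_self _
  have h3 : ∫ t in s..b, |l t| ≤ ∫ t in a..b, |l t| :=
    intervalIntegral.integral_mono_interval hs.1 hs.2 le_rfl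
      (Eventually.of_forall fun t => abs_nonneg _) hl.abs
  linarith

end AbsolutelyContinuous

/-! ### Comparison of solutions -/

section Comparison

variable {G : ℝ → ℝ → Set ℝ} {u w : ℝ → ℝ} {a b : ℝ}

lemma IsSolutionOn.mono {I J : Set ℝ} (hu : IsSolutionOn G u I) (hJ : J ⊆ I) :
    IsSolutionOn G u J :=
  ⟨fun a b hab h => hu.1 a b hab (h.trans hJ), hu.2.mono fun _ ht htJ => ht (hJ htJ)⟩

lemma IsSolutionOn.absolutelyContinuous (hu : IsSolutionOn G u (Icc a b)) (hab : a ≤ b) :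
    AbsolutelyContinuousOnInterval u a b :=
  hu.1 a b hab Subset.rfl

lemma IsSolutionOn.continuousOn (hu : IsSolutionOn G u (Icc a b)) (hab : a ≤ b) :
    ContinuousOn u (Icc a b) := by
  simpa [uIcc_of_le hab] using (hu.absolutelyContinuous hab).continuousOn

lemma IsSolutionOn.ae_deriv_mem {I : Set ℝ} (hu : IsSolutionOn G u I) :
    ∀ᵐ t, t ∈ I → deriv u t ∈ G t (u t) := by
  filter_upwards [hu.2] with t ht htI
  obtain ⟨y, hy, hd⟩ := ht htI
  rwa [hd.deriv]

/-- The distance of two solutions of an inclusion with decreasing right-hand side decreases. -/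
lemma IsSolutionOn.antitoneOn_abs_sub (hG : ∀ t, MonotoneDecreasing (G t))
    (hu : IsSolutionOn G u (Icc a b)) (hw : IsSolutionOn G w (Icc a b)) :
    AntitoneOn (fun t => |u t - w t|) (Icc a b) := by
  intro s hs t ht hst
  have hsub : Icc s t ⊆ Icc a b := Icc_subset_Icc hs.1 ht.2
  have hd := (hu.1 s t hst hsub).sub (hw.1 s t hst hsub)
  -- The square is used because, unlike the absolute value, it is differentiable also where the
  -- solutions meet.
  have key := sub_le_integral_of_deriv_le (l := fun _ => 0) hst (hd.mul hd)
    intervalIntegrable_const (by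
      filter_upwards [hu.2, hw.2] with r h1 h2 hr
      obtain ⟨y, hy, hyd⟩ := h1 (hsub hr)
      obtain ⟨z, hz, hzd⟩ := h2 (hsub hr)
      have hprod := (hyd.sub hzd).mul (hyd.sub hzd)
      rw [hprod.deriv]
      simp only [Pi.sub_apply]
      by_cases hne : w r = u r
      · simp [hne]
      · have := hG r (w r) (u r) hne z hz y hy
        linarith)
  simp only [Pi.mul_apply, Pi.sub_apply, intervalIntegral.integral_zero] at key
  exact sq_le_sq.1 (by nlinarith)

lemma IsSolutionOn.eqOn (hG : ∀ t, MonotoneDecreasing (G t))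
    (hu : IsSolutionOn G u (Icc a b)) (hw : IsSolutionOn G w (Icc a b)) (h : u a = w a) :
    EqOn u w (Icc a b) := by
  intro t ht
  have := hu.antitoneOn_abs_sub hG hw ⟨le_rfl, ht.1.trans ht.2⟩ ht ht.1
  simp only [h, sub_self, abs_zero] at this
  exact sub_eq_zero.1 (abs_nonpos_iff.1 this)

/-- To exchange order the solutions would have to meet, and from then on their distance stays zero.
-/
lemma IsSolutionOn.le_of_le (hG : ∀ t, MonotoneDecreasing (G t))
    (hu : IsSolutionOn G u (Icc a b)) (hw : IsSolutionOn G w (Icc a b)) (h : u a ≤ w a)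
    {t : ℝ} (ht : t ∈ Icc a b) : u t ≤ w t := by
  by_contra! hlt
  have hsub : Icc a t ⊆ Icc a b := Icc_subset_Icc_right ht.2
  have hab : a ≤ b := ht.1.trans ht.2
  have hcont : ContinuousOn (fun s => u s - w s) (Icc a t) :=
    ((hu.continuousOn hab).sub (hw.continuousOn hab)).mono hsub
  obtain ⟨s, hs, hs0⟩ := intermediate_value_Icc ht.1 hcont
    (show (0 : ℝ) ∈ Icc (u a - w a) (u t - w t) from ⟨by linarith, by linarith⟩)
  have := hu.antitoneOn_abs_sub hG hw (hsub hs) ht hs.2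
  simp only [hs0, abs_zero, abs_nonpos_iff] at this
  linarith

end Comparison

/-! ### Euler polygons for a right-hand side dominated by an integrable function -/

section Euler

/-- The nodes of the explicit Euler scheme with step `h`. -/
noncomputable def eulerNode (g : ℝ → ℝ → ℝ) (x₀ h : ℝ) : ℕ → ℝ
  | 0 => x₀
  | k + 1 => eulerNode g x₀ h k + ∫ s in (k * h)..((k + 1 : ℕ) * h), g s (eulerNode g x₀ h k)

/-- The piecewise constant function through the nodes. -/
noncomputable def eulerStep (g : ℝ → ℝ → ℝ) (x₀ h s : ℝ) : ℝ :=
  eulerNode g x₀ h (⌈s / h⌉₊ - 1)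

/-- The Euler polygon. -/
noncomputable def eulerPolygon (g : ℝ → ℝ → ℝ) (x₀ h t : ℝ) : ℝ :=
  x₀ + ∫ s in (0 : ℝ)..t, g s (eulerStep g x₀ h s)

variable {g : ℝ → ℝ → ℝ} {m : ℝ → ℝ}

/-- No joint measurability of `g` is assumed. Only countably many states occur, so measurable
representatives can be glued and the exceptional null sets united. -/
lemma aemeasurable_comp_countable (hmeas : ∀ u, AEMeasurable (fun t => g t u) volume)
    (X : ℕ → ℝ) {κ : ℝ → ℕ} (hκ : Measurable κ) :
    AEMeasurable (fun t => g t (X (κ t))) volume := by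
  let F : ℝ × ℕ → ℝ := fun z => (hmeas (X z.2)).mk _ z.1
  have hF : Measurable F :=
    measurable_from_prod_countable_left fun k => (hmeas (X k)).measurable_mk
  refine ⟨fun t => F (t, κ t), hF.comp (measurable_id.prodMk hκ), ?_⟩
  filter_upwards [ae_all_iff.2 fun k => (hmeas (X k)).ae_eq_mk] with t ht
  exact ht (κ t)

lemma integrable_comp_eulerStep (hmeas : ∀ u, AEMeasurable (fun t => g t u) volume)
    (hm : Integrable m volume) (hb : ∀ᵐ t, ∀ u, |g t u| ≤ m t) (x₀ h : ℝ) :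
    Integrable (fun t => g t (eulerStep g x₀ h t)) volume := by
  have hκ : Measurable fun s : ℝ => ⌈s / h⌉₊ - 1 :=
    (measurable_from_top (f := fun n : ℕ => n - 1)).comp
      (Nat.measurable_ceil.comp (measurable_id.div_const h))
  refine hm.mono' (aemeasurable_comp_countable hmeas _ hκ).aestronglyMeasurable ?_
  filter_upwards [hb] with t ht
  exact ht _

lemma eulerPolygon_sub (hmeas : ∀ u, AEMeasurable (fun t => g t u) volume)
    (hm : Integrable m volume) (hb : ∀ᵐ t, ∀ u, |g t u| ≤ m t) (x₀ h s t : ℝ) :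
    eulerPolygon g x₀ h t - eulerPolygon g x₀ h s
      = ∫ r in s..t, g r (eulerStep g x₀ h r) := by
  have hi := integrable_comp_eulerStep hmeas hm hb x₀ h
  rw [eulerPolygon, eulerPolygon, add_sub_add_left_eq_sub,
    intervalIntegral.integral_interval_sub_left hi.intervalIntegrable hi.intervalIntegrable]

/-- The modulus on the right does not depend on the step, which is what compactness requires. -/
lemma dist_eulerPolygon_le (hmeas : ∀ u, AEMeasurable (fun t => g t u) volume)
    (hm : Integrable m volume) (hb : ∀ᵐ t, ∀ u, |g t u| ≤ m t) (x₀ h s t : ℝ) :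
    dist (eulerPolygon g x₀ h s) (eulerPolygon g x₀ h t)
      ≤ dist (∫ r in (0 : ℝ)..s, m r) (∫ r in (0 : ℝ)..t, m r) := by
  rw [dist_comm, Real.dist_eq, eulerPolygon_sub hmeas hm hb, dist_comm, Real.dist_eq,
    intervalIntegral.integral_interval_sub_left hm.intervalIntegrable hm.intervalIntegrable]
  have hle : ∀ᵐ r, ‖g r (eulerStep g x₀ h r)‖ ≤ m r := hb.mono fun r hr => hr _
  exact intervalIntegral.norm_integral_le_abs_of_norm_le (ae_restrict_of_ae hle)
    hm.intervalIntegrable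

/-- On this left-open interval the ceiling is `k + 1`, which explains the subtraction of one. The
half-open shape matches that of interval integrals. -/
lemma eulerStep_of_mem_Ioc {x₀ h s : ℝ} (hh : 0 < h) {k : ℕ}
    (hs : s ∈ Ioc (k * h) ((k + 1 : ℕ) * h)) : eulerStep g x₀ h s = eulerNode g x₀ h k := by
  have : ⌈s / h⌉₊ = k + 1 := by
    rw [Nat.ceil_eq_iff (by simp)]
    constructor
    · rw [lt_div_iff₀ hh]
      simpa using hs.1
    · rw [div_le_iff₀ hh]
      exact hs.2
  rw [eulerStep, this, Nat.add_sub_cancel]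

lemma eulerPolygon_node (hmeas : ∀ u, AEMeasurable (fun t => g t u) volume)
    (hm : Integrable m volume) (hb : ∀ᵐ t, ∀ u, |g t u| ≤ m t) {x₀ h : ℝ} (hh : 0 < h) (k : ℕ) :
    eulerPolygon g x₀ h (k * h) = eulerNode g x₀ h k := by
  induction k with
  | zero => simp [eulerPolygon, eulerNode]
  | succ k ih =>
    have hle : (k : ℝ) * h ≤ (k + 1 : ℕ) * h := by push_cast; nlinarith
    rw [eulerNode, ← ih, ← sub_eq_iff_eq_add', eulerPolygon_sub hmeas hm hb]
    refine intervalIntegral.integral_congr_ae (Eventually.of_forall fun s hs => ?_)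
    rw [uIoc_of_le hle] at hs
    rw [eulerStep_of_mem_Ioc hh hs, ih]

/-- The polygon and the step function are close to each other for small step sizes. -/
lemma tendsto_eulerPolygon_sub_eulerStep (hmeas : ∀ u, AEMeasurable (fun t => g t u) volume)
    (hm : Integrable m volume) (hb : ∀ᵐ t, ∀ u, |g t u| ≤ m t) (x₀ : ℝ) {h : ℕ → ℝ}
    (hpos : ∀ n, 0 < h n) (hlim : Tendsto h atTop (𝓝 0)) {t : ℝ} (ht : 0 < t) :
    Tendsto (fun n => eulerPolygon g x₀ (h n) t - eulerStep g x₀ (h n) t) atTop (𝓝 0) := by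
  -- `τ n` is the last mesh point strictly before `t`, so `t - h n ≤ τ n < t`; this needs `t > 0`.
  let κ : ℕ → ℕ := fun n => ⌈t / h n⌉₊ - 1
  let τ : ℕ → ℝ := fun n => κ n * h n
  have hκ (n : ℕ) : t ∈ Ioc (τ n) ((κ n + 1 : ℕ) * h n) := by
    have hc : 0 < ⌈t / h n⌉₊ := Nat.ceil_pos.2 (div_pos ht (hpos n))
    have h1 : ⌈t / h n⌉₊ = κ n + 1 := by simp only [κ]; omega
    have h2 := (Nat.ceil_eq_iff (by simp)).1 h1
    rw [lt_div_iff₀ (hpos n), div_le_iff₀ (hpos n)] at h2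
    simpa [τ] using h2
  have hτ : Tendsto τ atTop (𝓝 t) := by
    refine tendsto_of_tendsto_of_tendsto_of_le_of_le (g := fun n => t - h n) (h := fun _ => t)
      (by simpa using tendsto_const_nhds.sub hlim) tendsto_const_nhds (fun n => ?_)
      fun n => (hκ n).1.le
    have := (hκ n).2
    push_cast at this
    simp only [τ]
    linarith
  have hM : Tendsto (fun n => dist (∫ r in (0 : ℝ)..t, m r) (∫ r in (0 : ℝ)..τ n, m r)) atTop
      (𝓝 0) := by
    have hc := intervalIntegral.continuous_primitive (fun a b => hm.intervalIntegrable) (0 : ℝ)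
    simpa using (tendsto_const_nhds (x := ∫ r in (0 : ℝ)..t, m r)).dist
      ((hc.tendsto t).comp hτ)
  refine squeeze_zero_norm (fun n => ?_) hM
  rw [eulerStep_of_mem_Ioc (hpos n) (hκ n), ← eulerPolygon_node hmeas hm hb (hpos n),
    ← dist_eq_norm]
  exact dist_eulerPolygon_le hmeas hm hb _ _ _ _

/-- Functions on `[0,T]` with a common modulus of continuity and a common value at `0` have a
pointwise convergent subsequence. -/
lemma exists_subseq_tendsto_of_modulus {T x₀ : ℝ} (hT : 0 ≤ T) {M : ℝ → ℝ} (hM : Continuous M)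
    {u : ℕ → ℝ → ℝ} (h0 : ∀ n, u n 0 = x₀)
    (hu : ∀ n s t, dist (u n s) (u n t) ≤ dist (M s) (M t)) :
    ∃ φ : ℕ → ℕ, StrictMono φ ∧ ∃ v : ℝ → ℝ,
      ∀ t ∈ Icc 0 T, Tendsto (fun n => u (φ n) t) atTop (𝓝 (v t)) := by
  have hcont (n : ℕ) : Continuous (u n) := by
    refine continuous_iff_continuousAt.2 fun t => tendsto_iff_dist_tendsto_zero.2 ?_
    refine squeeze_zero (fun _ => dist_nonneg) (fun s => hu n s t) ?_
    simpa using (hM.tendsto t).dist (tendsto_const_nhds (x := M t))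
  let U : ℕ → BoundedContinuousFunction (Icc (0 : ℝ) T) ℝ := fun n =>
    BoundedContinuousFunction.mkOfCompact ⟨fun t => u n t, (hcont n).comp continuous_subtype_val⟩
  have hU (n : ℕ) (t : Icc (0 : ℝ) T) : U n t = u n t := rfl
  obtain ⟨C, hC⟩ := isCompact_Icc.exists_bound_of_continuousOn
    (hM.continuousOn (s := Icc (0 : ℝ) T))
  have hcomp : IsCompact (closure (range U)) := by
    refine BoundedContinuousFunction.arzela_ascoli (Metric.closedBall x₀ (C + C))
      (isCompact_closedBall _ _) _ ?_ ?_
    · rintro _ t ⟨n, rfl⟩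
      rw [Metric.mem_closedBall, hU, ← h0 n]
      refine (hu n _ _).trans ((dist_le_norm_add_norm _ _).trans ?_)
      exact add_le_add (hC t t.2) (hC 0 ⟨le_rfl, hT⟩)
    · intro t
      refine Metric.equicontinuousAt_of_continuity_modulus
        (fun s : Icc (0 : ℝ) T => dist (M t) (M s)) ?_ _ (Eventually.of_forall ?_)
      · have : Continuous fun s : Icc (0 : ℝ) T => dist (M t) (M s) := by fun_prop
        simpa using this.tendsto t
      · rintro s ⟨_, n, rfl⟩
        exact hu n t s
  obtain ⟨V, -, φ, hφ, hlim⟩ := hcomp.tendsto_subseq fun n => subset_closure (mem_range_self n)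
  refine ⟨φ, hφ, fun t => V (projIcc 0 T hT t), fun t ht => ?_⟩
  simp only [projIcc_of_mem hT ht]
  have hev : Continuous fun f : BoundedContinuousFunction (Icc (0 : ℝ) T) ℝ => f ⟨t, ht⟩ :=
    continuous_eval_const _
  exact (hev.tendsto V).comp hlim

/-- The derivative of a limit of primitives is bounded by the suprema of the integrands. -/
lemma ae_deriv_le_iSup {T : ℝ} {H : ℕ → ℝ → ℝ} {w : ℕ → ℝ → ℝ} {v : ℝ → ℝ}
    (hm : Integrable m volume) (hH : ∀ k, AEMeasurable (H k) volume)
    (hb : ∀ᵐ t, ∀ k, |H k t| ≤ m t) (hw : ∀ k s t, w k t - w k s = ∫ r in s..t, H k r)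
    (hlim : ∀ t ∈ Icc 0 T, Tendsto (fun k => w k t) atTop (𝓝 (v t))) :
    ∀ᵐ t, t ∈ Icc 0 T → ∀ y, HasDerivAt v y t → ∀ n, y ≤ ⨆ k, H (n + k) t := by
  have hbdd {t : ℝ} (ht : ∀ k, |H k t| ≤ m t) (n : ℕ) :
      BddAbove (range fun k => H (n + k) t) := by
    refine ⟨m t, ?_⟩
    rintro _ ⟨k, rfl⟩
    exact (le_abs_self _).trans (ht _)
  have hSint (n : ℕ) : Integrable (fun t => ⨆ k, H (n + k) t) volume := by
    refine hm.mono' (AEMeasurable.iSup fun k => hH (n + k)).aestronglyMeasurable ?_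
    filter_upwards [hb] with t ht
    refine abs_le.2 ⟨?_, ciSup_le fun k => (le_abs_self _).trans (ht _)⟩
    exact (abs_le.1 (ht (n + 0))).1.trans (le_ciSup (hbdd ht n) 0)
  have hHint (k : ℕ) : Integrable (H k) volume := by
    refine hm.mono' (hH k).aestronglyMeasurable ?_
    filter_upwards [hb] with t ht using ht k
  -- From index `n` on, the integrands are at most their tail supremum, so in the limit `v` grows no
  -- faster than its primitive. Differentiating this comparison yields the claim.
  have hmono (n : ℕ) :
      MonotoneOn (fun t => (∫ r in (0 : ℝ)..t, ⨆ k, H (n + k) r) - v t) (Icc 0 T) := by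
    intro s hs t ht hst
    have h1 : v t - v s ≤ ∫ r in s..t, ⨆ k, H (n + k) r := by
      refine le_of_tendsto ((hlim t ht).sub (hlim s hs)) ?_
      filter_upwards [eventually_ge_atTop n] with j hj
      rw [hw]
      refine intervalIntegral.integral_mono_ae hst (hHint j).intervalIntegrable
        (hSint n).intervalIntegrable ?_
      filter_upwards [hb] with r hr
      simpa [Nat.add_sub_cancel' hj] using le_ciSup (hbdd hr n) (j - n)
    have h2 := intervalIntegral.integral_interval_sub_left
      (hSint n).intervalIntegrable (hSint n).intervalIntegrable (a := 0) (b := t) (c := s)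
    dsimp only
    linarith
  have hne0 : ∀ᵐ t : ℝ, t ≠ 0 := by simp [ae_iff, measure_singleton]
  have hneT : ∀ᵐ t : ℝ, t ≠ T := by simp [ae_iff, measure_singleton]
  filter_upwards [ae_all_iff.2 fun n => LocallyIntegrable.ae_hasDerivAt_integral
    (hSint n).locallyIntegrable,
    hne0, hneT] with t ht h0 h1 htI y hy n
  have hnhds : Icc 0 T ∈ 𝓝 t :=
    Icc_mem_nhds (lt_of_le_of_ne htI.1 h0.symm) (lt_of_le_of_ne htI.2 h1)
  have hd := (ht n 0).sub hy
  have := (hmono n).derivWithin_nonneg (x := t)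
  rw [derivWithin_of_mem_nhds hnhds] at this
  have h3 := hd.deriv
  simp only [Pi.sub_def] at h3
  rw [h3] at this
  linarith

/-- Near-maximizers of the tails stay bounded, and any cluster value of theirs is at least `y`. -/
lemma exists_tendsto_ge_of_le_iSup {a : ℕ → ℝ} {C y : ℝ} (hb : ∀ k, |a k| ≤ C)
    (hy : ∀ n, y ≤ ⨆ k, a (n + k)) :
    ∃ φ : ℕ → ℕ, Tendsto φ atTop atTop ∧ ∃ z, y ≤ z ∧ Tendsto (a ∘ φ) atTop (𝓝 z) := by
  have h1 (n : ℕ) : ∃ k, y - 1 / ((n : ℝ) + 1) < a (n + k) :=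
    exists_lt_of_lt_ciSup ((sub_lt_self y (by positivity)).trans_le (hy n))
  choose k hk using h1
  obtain ⟨z, -, φ, hφ, hz⟩ := (isCompact_Icc (a := -C) (b := C)).tendsto_subseq
    (x := fun n => a (n + k n)) fun n => abs_le.1 (hb _)
  refine ⟨fun n => φ n + k (φ n), tendsto_atTop_mono (fun n => Nat.le_add_right _ _)
    hφ.tendsto_atTop, z, ?_, hz⟩
  have h2 : Tendsto (fun n => y - 1 / ((φ n : ℝ) + 1)) atTop (𝓝 (y - 0)) :=
    tendsto_const_nhds.sub (tendsto_one_div_add_atTop_nhds_zero_nat.comp hφ.tendsto_atTop)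
  rw [sub_zero] at h2
  exact le_of_tendsto_of_tendsto' h2 hz fun n => (hk _).le

/-- Existence for a differential inclusion whose right-hand side has convex values, a closed graph
in the state variable, and a measurable selection dominated by an integrable function. -/
theorem exists_isSolutionOn_of_dominated {T : ℝ} (hT : 0 < T) {F : ℝ → ℝ → Set ℝ}
    (hF : ∀ t, IsClosed (graph (F t))) (hconv : ∀ t u, (F t u).OrdConnected)
    (hmeas : ∀ u, AEMeasurable (fun t => g t u) volume) (hm : Integrable m volume)
    (hb : ∀ᵐ t, ∀ u, |g t u| ≤ m t) (hg : ∀ t ∈ Ioc 0 T, ∀ u, g t u ∈ F t u) (x₀ : ℝ) :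
    ∃ v : ℝ → ℝ, IsSolutionOn F v (Icc 0 T) ∧ v 0 = x₀ := by
  let h : ℕ → ℝ := fun n => 1 / ((n : ℝ) + 1)
  have hpos (n : ℕ) : 0 < h n := by positivity
  have hlim : Tendsto h atTop (𝓝 0) := tendsto_one_div_add_atTop_nhds_zero_nat
  let M : ℝ → ℝ := fun t => ∫ r in (0 : ℝ)..t, m r
  have hM : Continuous M :=
    intervalIntegral.continuous_primitive (fun a b => hm.intervalIntegrable) 0
  obtain ⟨φ, hφ, v, hv⟩ := exists_subseq_tendsto_of_modulus (x₀ := x₀) hT.le hM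
    (u := fun n => eulerPolygon g x₀ (h n)) (fun n => by simp [eulerPolygon])
    fun n s t => dist_eulerPolygon_le hmeas hm hb x₀ (h n) s t
  have hv0 : v 0 = x₀ := by
    refine tendsto_nhds_unique (hv 0 ⟨le_rfl, hT.le⟩) ?_
    simp [eulerPolygon]
  have hvM : ∀ s ∈ Icc 0 T, ∀ t ∈ Icc 0 T, dist (v s) (v t) ≤ dist (M s) (M t) :=
    fun s hs t ht => le_of_tendsto' ((hv s hs).dist (hv t ht)) fun n =>
      dist_eulerPolygon_le hmeas hm hb x₀ (h (φ n)) s t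
  have hac {a b : ℝ} (hab : a ≤ b) (hI : Icc a b ⊆ Icc 0 T) :
      AbsolutelyContinuousOnInterval v a b := by
    have hMac : AbsolutelyContinuousOnInterval M 0 T :=
      hm.intervalIntegrable.absolutelyContinuousOnInterval_intervalIntegral left_mem_uIcc
    have hI' : uIcc a b ⊆ Icc 0 T := by rwa [uIcc_of_le hab]
    refine absolutelyContinuousOnInterval_of_dist_le
      (hMac.mono (hI'.trans Icc_subset_uIcc)) fun s hs t ht => hvM s (hI' hs) t (hI' ht)
  refine ⟨v, ⟨fun a b hab hI => hac hab hI, ?_⟩, hv0⟩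
  let H : ℕ → ℝ → ℝ := fun k t => g t (eulerStep g x₀ (h (φ k)) t)
  have hHm (k : ℕ) : AEMeasurable (H k) volume :=
    (integrable_comp_eulerStep hmeas hm hb x₀ (h (φ k))).aemeasurable
  have hHb : ∀ᵐ t, ∀ k, |H k t| ≤ m t := hb.mono fun t ht k => ht _
  have hup := ae_deriv_le_iSup hm hHm hHb
    (fun k s t => eulerPolygon_sub hmeas hm hb x₀ (h (φ k)) s t) hv
  -- Changing signs turns the upper estimate of the derivative into a lower one.
  have hlow := ae_deriv_le_iSup (H := fun k t => -H k t)
    (w := fun k t => -eulerPolygon g x₀ (h (φ k)) t) (v := fun t => -v t) hm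
    (fun k => (hHm k).neg) (by simpa using hHb)
    (fun k s t => by
      rw [intervalIntegral.integral_neg, ← eulerPolygon_sub hmeas hm hb x₀ (h (φ k)) s t]
      ring) fun t ht => (hv t ht).neg
  have hne0 : ∀ᵐ t : ℝ, t ≠ 0 := by simp [ae_iff, measure_singleton]
  have hdiff := (hac hT.le Subset.rfl).ae_differentiableAt
  filter_upwards [hup, hlow, hne0, hdiff, hHb] with t h1 h2 h0 hd hbt htI
  have ht0 : 0 < t := lt_of_le_of_ne htI.1 h0.symm
  have hdt := (hd (Icc_subset_uIcc htI)).hasDerivAt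
  have hstep : Tendsto (fun k => eulerStep g x₀ (h (φ k)) t) atTop (𝓝 (v t)) := by
    have := (hv t htI).sub ((tendsto_eulerPolygon_sub_eulerStep hmeas hm hb x₀ hpos hlim
      ht0).comp hφ.tendsto_atTop)
    simpa using this
  -- By the closed graph, every cluster value of the slopes at `t` is admissible. Two of them
  -- enclose `deriv v t`, so convexity finishes.
  have hmem {ψ : ℕ → ℕ} (hψ : Tendsto ψ atTop atTop) {z : ℝ}
      (hz : Tendsto (fun n => H (ψ n) t) atTop (𝓝 z)) : z ∈ F t (v t) := by
    have : ((v t, z) : ℝ × ℝ) ∈ graph (F t) :=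
      (hF t).mem_of_tendsto ((hstep.comp hψ).prodMk_nhds hz)
        (Eventually.of_forall fun n => hg t ⟨ht0, htI.2⟩ _)
    exact this
  obtain ⟨ψ₁, hψ₁, z₁, hz₁, hz₁'⟩ := exists_tendsto_ge_of_le_iSup hbt (h1 htI _ hdt)
  obtain ⟨ψ₂, hψ₂, z₂, hz₂, hz₂'⟩ := exists_tendsto_ge_of_le_iSup
    (a := fun k => -H k t) (by simpa using hbt) (h2 htI _ hdt.neg)
  have hz₂'' : Tendsto (fun n => H (ψ₂ n) t) atTop (𝓝 (-z₂)) := by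
    simpa [Function.comp_def] using hz₂'.neg
  exact ⟨deriv v t, (hconv t _).out (hmem hψ₂ hz₂'') (hmem hψ₁ hz₁')
    ⟨by linarith, hz₁⟩, hdt⟩

end Euler

/-! ### Maximal monotone maps -/

section Maximal

variable {F : ℝ → Set ℝ}

/-- A point compatible with the whole graph could be adjoined to it, contradicting maximality. -/
lemma MaximalMonotoneIncreasing.mem_iff (hF : MaximalMonotoneIncreasing F) {u y : ℝ} :
    y ∈ F u ↔ ∀ v, v ≠ u → ∀ b ∈ F v, 0 ≤ (b - y) * (v - u) := by
  refine ⟨fun hy v hv b hb => hF.1 u v hv.symm y hy b hb, fun h => ?_⟩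
  by_contra hy
  let F' : ℝ → Set ℝ := fun v => {b | b ∈ F v ∨ v = u ∧ b = y}
  refine hF.2 ⟨F', ?_, ?_⟩
  · rintro u₁ u₂ hne y₁ (h₁ | ⟨rfl, rfl⟩) y₂ (h₂ | ⟨rfl, rfl⟩)
    · exact hF.1 u₁ u₂ hne y₁ h₁ y₂ h₂
    · linarith [h u₁ hne y₁ h₁]
    · exact h u₂ hne.symm y₂ h₂
    · exact absurd rfl hne
  · rw [ssubset_def]
    refine ⟨fun z hz => Or.inl hz, fun hsub => hy ?_⟩
    exact hsub (show ((u, y) : ℝ × ℝ) ∈ graph F' from Or.inr ⟨rfl, rfl⟩)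

lemma MaximalMonotoneIncreasing.ordConnected (hF : MaximalMonotoneIncreasing F) (u : ℝ) :
    (F u).OrdConnected := by
  refine ⟨fun x hx y hy z hz => hF.mem_iff.2 fun v hv b hb => ?_⟩
  have h1 := hF.mem_iff.1 hx v hv b hb
  have h2 := hF.mem_iff.1 hy v hv b hb
  rcases lt_or_gt_of_ne hv with h | h
  · nlinarith [hz.1]
  · nlinarith [hz.2]

/-- Violating monotonicity against a fixed graph point is an open condition, so it would pass from a
limit point to points of the graph. -/
lemma MaximalMonotoneIncreasing.isClosed_graph (hF : MaximalMonotoneIncreasing F) :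
    IsClosed (graph F) := by
  refine isClosed_of_closure_subset fun z hz => ?_
  refine hF.mem_iff.2 fun v hv b hb => ?_
  by_contra! hlt
  have hc : Continuous fun x : ℝ × ℝ => (b - x.2) * (v - x.1) := by fun_prop
  have hnhds : {x : ℝ × ℝ | (b - x.2) * (v - x.1) < 0} ∈ 𝓝 z :=
    (isOpen_Iio.preimage hc).mem_nhds hlt
  obtain ⟨x, hx, hxF⟩ := mem_closure_iff_nhds.1 hz _ hnhds
  have hne : v ≠ x.1 := by
    rintro rfl
    simp at hx
  exact (not_le.2 hx) (hF.1 x.1 v hne.symm x.2 hxF b hb)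

lemma MaximalMonotoneIncreasing.isClosed (hF : MaximalMonotoneIncreasing F) (u : ℝ) :
    IsClosed (F u) :=
  hF.isClosed_graph.preimage (show Continuous fun y : ℝ => (u, y) by fun_prop)

lemma MonotoneIncreasing.bddAbove (hF : MonotoneIncreasing F) (hne : ∀ u, (F u).Nonempty)
    (u : ℝ) : BddAbove (F u) := by
  obtain ⟨b, hb⟩ := hne (u + 1)
  refine ⟨b, fun y hy => ?_⟩
  have := hF u (u + 1) (by simp) y hy b hb
  linarith

/-- The supremum exceeds `c` exactly when `A t` meets the open set `Ioi c`. -/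
lemma aemeasurable_sSup {A : ℝ → Set ℝ} (hA : SetValuedMeasurable A)
    (hne : ∀ t, (A t).Nonempty) (hbdd : ∀ t, BddAbove (A t)) :
    AEMeasurable (fun t => sSup (A t)) volume := by
  refine NullMeasurable.aemeasurable ?_
  have : @Measurable (NullMeasurableSpace ℝ volume) ℝ _ _ fun t => sSup (A t) := by
    refine measurable_of_Ioi fun c => ?_
    have heq : (fun t => sSup (A t)) ⁻¹' Ioi c = {t | (A t ∩ Ioi c).Nonempty} :=
      Set.ext fun t => lt_csSup_iff (hbdd t) (hne t)
    have h := hA (Ioi c) isOpen_Ioi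
    rw [← heq] at h
    exact h
  exact fun s hs => this hs

end Maximal

lemma LipschitzPart.continuous {T : ℝ} {p : ℝ → ℝ → ℝ} (hp : LipschitzPart T p) (t : ℝ) :
    Continuous (p t) := by
  refine continuous_iff_continuousAt.2 fun u => ?_
  obtain ⟨L, hL⟩ := hp.lipschitz (|u| + 1)
  refine (hL t).continuousOn.continuousAt (Icc_mem_nhds ?_ ?_)
  · linarith [neg_abs_le u]
  · linarith [le_abs_self u]

/-! ### Existence of solutions -/

section Existence

variable {T R : ℝ} {G : ℝ → ℝ → Set ℝ} {lm lp : ℝ → ℝ}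

lemma StructuralForm.periodic (hG : StructuralForm T G) (t u : ℝ) : G (t + T) u = G t u := by
  obtain ⟨A, p, hA, hp, hform⟩ := hG
  rw [hform, hform, hA.periodic, hp.periodic]

lemma StructuralForm.isClosed_graph (hG : StructuralForm T G) (t : ℝ) :
    IsClosed (graph (G t)) := by
  obtain ⟨A, p, hA, hp, hform⟩ := hG
  have hpc := hp.continuous t
  have : graph (G t) = (fun z : ℝ × ℝ => (z.1, p t z.1 - z.2)) ⁻¹' graph (A t) := by
    ext z
    simp only [graph, hform, mem_ofPred_eq, mem_preimage]
    refine ⟨?_, fun h => ⟨_, h, by ring⟩⟩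
    rintro ⟨a, ha, hz⟩
    rw [hz]
    convert ha using 1
    ring
  rw [this]
  exact (hA.maximal t).isClosed_graph.preimage (by fun_prop)

lemma StructuralForm.ordConnected (hG : StructuralForm T G) (t u : ℝ) :
    (G t u).OrdConnected := by
  obtain ⟨A, p, hA, hp, hform⟩ := hG
  rw [hform]
  refine ⟨?_⟩
  rintro _ ⟨a, ha, rfl⟩ _ ⟨b, hb, rfl⟩ z hz
  refine ⟨p t u - z, ((hA.maximal t).ordConnected u).out hb ha ⟨?_, ?_⟩, by ring⟩
  · linarith [hz.2]
  · linarith [hz.1]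

/-- The values of the monotone part are closed and bounded above, so their largest element is a
measurable selection. -/
lemma StructuralForm.exists_selection (hG : StructuralForm T G) :
    ∃ g : ℝ → ℝ → ℝ, (∀ u, AEMeasurable (fun t => g t u) volume) ∧ ∀ t u, g t u ∈ G t u := by
  obtain ⟨A, p, hA, hp, hform⟩ := hG
  have hbdd (t u : ℝ) : BddAbove (A t u) := (hA.maximal t).1.bddAbove (hA.nonempty t) u
  refine ⟨fun t u => -sSup (A t u) + p t u, fun u => ?_, fun t u => ?_⟩
  · exact (aemeasurable_sSup (hA.measurable u) (fun t => hA.nonempty t u)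
      fun t => hbdd t u).neg.add (hp.measurable u)
  · rw [hform]
    exact ⟨_, ((hA.maximal t).isClosed u).csSup_mem (hA.nonempty t u) (hbdd t u), rfl⟩

/-- The dissipativity bounds at `±r` control the single-valued part, which need not be locally
integrable by itself. -/
lemma StructuralForm.exists_bound (hG : StructuralForm T G) (hd : Dissipative T G R lm lp)
    {r : ℝ} (hr : R ≤ r) :
    ∃ m : ℝ → ℝ, IntervalIntegrable m volume 0 T ∧
      ∀ᵐ t, ∀ u ∈ Icc (-r) r, ∀ y ∈ G t u, |y| ≤ m t := by
  obtain ⟨A, p, hA, hp, hform⟩ := hG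
  obtain ⟨m, hm, hmb⟩ := hA.bounded r
  obtain ⟨L, hL⟩ := hp.lipschitz r
  have hr0 : 0 < r := hd.R_pos.trans_le hr
  have hm' : IntervalIntegrable m volume 0 T :=
    (hm.integrableOn_isCompact isCompact_uIcc).intervalIntegrable
  refine ⟨fun t => m t + (m t + |lp t| + |lm t| + L * (2 * r)),
    hm'.add (((hm'.add hd.lp_integrable.abs).add hd.lm_integrable.abs).add
      intervalIntegrable_const), ?_⟩
  filter_upwards [hmb, hd.lower, hd.upper] with t hmt hlow hup u hu y hy
  rw [hform] at hy
  obtain ⟨a, ha, rfl⟩ := hy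
  have hrmem : r ∈ Icc (-r) r := ⟨by linarith, le_rfl⟩
  have hnmem : -r ∈ Icc (-r) r := ⟨le_rfl, by linarith⟩
  obtain ⟨a₁, ha₁⟩ := hA.nonempty t r
  obtain ⟨a₂, ha₂⟩ := hA.nonempty t (-r)
  -- Dissipativity bounds `p t r` from above and `p t (-r)` from below; the Lipschitz constant
  -- carries both over a distance of at most `2 * r`.
  have h1 := hup r hr (-a₁ + p t r) (by rw [hform]; exact ⟨a₁, ha₁, rfl⟩)
  have h2 := hlow (-r) (by simpa using hr) (-a₂ + p t (-r)) (by rw [hform]; exact ⟨a₂, ha₂, rfl⟩)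
  have h3 := abs_le.1 (hmt r hrmem a₁ ha₁)
  have h4 := abs_le.1 (hmt (-r) hnmem a₂ ha₂)
  have h5 := abs_le.1 (hmt u hu a ha)
  have hL0 : (0 : ℝ) ≤ L := L.2
  have h6 : |p t u - p t r| ≤ L * (2 * r) := by
    refine ((hL t).dist_le_mul u hu r hrmem).trans (mul_le_mul_of_nonneg_left ?_ hL0)
    rw [Real.dist_eq, abs_le]
    constructor <;> linarith [hu.1, hu.2]
  have h7 : |p t u - p t (-r)| ≤ L * (2 * r) := by
    refine ((hL t).dist_le_mul u hu (-r) hnmem).trans (mul_le_mul_of_nonneg_left ?_ hL0)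
    rw [Real.dist_eq, abs_le]
    constructor <;> linarith [hu.1, hu.2]
  have h8 := abs_le.1 h6
  have h9 := abs_le.1 h7
  have h10 := abs_le.1 (le_refl |lp t|)
  have h11 := abs_le.1 (le_refl |lm t|)
  rw [abs_le]
  constructor <;> linarith [abs_nonneg (lp t), abs_nonneg (lm t)]

/-! ### A priori bounds from dissipativity -/

section APriori

variable {u : ℝ → ℝ} {t : ℝ}

lemma Dissipative.upper_bound (hd : Dissipative T G R lm lp) (hu : IsSolutionOn G u (Icc 0 T))
    (ht : t ∈ Icc 0 T) :
    u t ≤ R + ∫ s in (0 : ℝ)..t, |lp s| ∨ u t ≤ u 0 + ∫ s in (0 : ℝ)..t, lp s := by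
  have hsub : Icc 0 t ⊆ Icc 0 T := Icc_subset_Icc_right ht.2
  refine le_add_integral_of_deriv_le ht.1 (hu.1 0 t ht.1 hsub)
    (hd.lp_integrable.mono_set ?_) ?_
  · rwa [uIcc_of_le ht.1, uIcc_of_le (ht.1.trans ht.2)]
  · filter_upwards [hu.ae_deriv_mem, hd.upper] with s h1 h2 hs hR
    exact h2 _ hR _ (h1 (hsub hs))

lemma Dissipative.lower_bound (hd : Dissipative T G R lm lp) (hu : IsSolutionOn G u (Icc 0 T))
    (ht : t ∈ Icc 0 T) :
    -R - ∫ s in (0 : ℝ)..t, |lm s| ≤ u t ∨ u 0 - ∫ s in (0 : ℝ)..t, lm s ≤ u t := by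
  have hsub : Icc 0 t ⊆ Icc 0 T := Icc_subset_Icc_right ht.2
  -- The upper estimate is applied to `-u`.
  have key := le_add_integral_of_deriv_le (R := R) ht.1 (hu.1 0 t ht.1 hsub).neg
    (hd.lm_integrable.mono_set (by rwa [uIcc_of_le ht.1, uIcc_of_le (ht.1.trans ht.2)])) (by
      filter_upwards [hu.ae_deriv_mem, hd.lower] with s h1 h2 hs hR
      rw [deriv.neg]
      simp only [Pi.neg_apply] at hR
      linarith [h2 (u s) (by simp only [mem_Iic]; linarith) _ (h1 (hsub hs))])
  simp only [Pi.neg_apply] at key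
  rcases key with h | h
  · left; linarith
  · right; linarith

lemma Dissipative.abs_le (hd : Dissipative T G R lm lp) (hu : IsSolutionOn G u (Icc 0 T))
    (ht : t ∈ Icc 0 T) :
    |u t| ≤ R + |u 0| + (∫ s in (0 : ℝ)..T, |lp s|) + ∫ s in (0 : ℝ)..T, |lm s| := by
  have h (l : ℝ → ℝ) (hl : IntervalIntegrable l volume 0 T) :
      0 ≤ ∫ s in (0 : ℝ)..t, |l s| ∧ ∫ s in (0 : ℝ)..t, |l s| ≤ ∫ s in (0 : ℝ)..T, |l s| ∧
        |∫ s in (0 : ℝ)..t, l s| ≤ ∫ s in (0 : ℝ)..t, |l s| :=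
    ⟨intervalIntegral.integral_nonneg ht.1 fun s _ => abs_nonneg _,
      intervalIntegral.integral_mono_interval le_rfl ht.1 ht.2
        (Eventually.of_forall fun s => abs_nonneg _) hl.abs,
      intervalIntegral.abs_integral_le_integral_abs ht.1⟩
  obtain ⟨h1, h2, h3⟩ := h lp hd.lp_integrable
  obtain ⟨h4, h5, h6⟩ := h lm hd.lm_integrable
  have := abs_nonneg (u 0)
  have := hd.R_pos
  refine _root_.abs_le.2 ⟨?_, ?_⟩
  · rcases hd.lower_bound hu ht with h' | h'
    · linarith
    · linarith [neg_abs_le (u 0), le_abs_self (∫ s in (0 : ℝ)..t, lm s)]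
  · rcases hd.upper_bound hu ht with h' | h'
    · linarith
    · linarith [le_abs_self (u 0), le_abs_self (∫ s in (0 : ℝ)..t, lp s)]

end APriori

/-- Freezing the right-hand side outside `[-r,r]` keeps it dissipative. -/
lemma Dissipative.truncate (hd : Dissipative T G R lm lp) {r : ℝ} (hr : R ≤ r) :
    Dissipative T (fun t u => G t (max (-r) (min r u))) R lm lp := by
  have := hd.R_pos
  refine { hd with lower := ?_, upper := ?_ }
  · filter_upwards [hd.lower] with t ht u hu y hy
    refine ht _ ?_ y hy
    exact max_le (neg_le_neg hr) ((min_le_right _ _).trans hu)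
  · filter_upwards [hd.upper] with t ht u hu y hy
    exact ht _ (le_max_of_le_right (le_min hr hu)) y hy

theorem exists_isSolutionOn (hT : 0 < T) (hG : StructuralForm T G)
    (hd : Dissipative T G R lm lp) (x₀ : ℝ) :
    ∃ u : ℝ → ℝ, IsSolutionOn G u (Icc 0 T) ∧ u 0 = x₀ := by
  -- This is the a priori bound for data `x₀`. The truncated inclusion obeys it too, so its solution
  -- never leaves `[-r, r]`.
  set r : ℝ := R + |x₀| + (∫ s in (0 : ℝ)..T, |lp s|) + ∫ s in (0 : ℝ)..T, |lm s| with hr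
  have hI (l : ℝ → ℝ) : 0 ≤ ∫ s in (0 : ℝ)..T, |l s| :=
    intervalIntegral.integral_nonneg hT.le fun s _ => abs_nonneg _
  have hRr : R ≤ r := by linarith [hI lp, hI lm, abs_nonneg x₀]
  have hr0 : 0 < r := hd.R_pos.trans_le hRr
  let κ : ℝ → ℝ := fun u => max (-r) (min r u)
  have hκc : Continuous κ := by fun_prop
  have hκ (u : ℝ) : κ u ∈ Icc (-r) r :=
    ⟨le_max_left _ _, max_le (by linarith) (min_le_left _ _)⟩
  obtain ⟨g, hgm, hg⟩ := hG.exists_selection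
  obtain ⟨m, hm, hmb⟩ := hG.exists_bound hd hRr
  obtain ⟨u, hu, hu0⟩ := exists_isSolutionOn_of_dominated hT (F := fun t u => G t (κ u))
    -- The dominating function is integrable only over `(0, T]`, so everything is set to zero
    -- elsewhere.
    (g := fun t u => (Ioc 0 T).indicator (fun t => g t (κ u)) t)
    (m := (Ioc 0 T).indicator m)
    (fun t => (hG.isClosed_graph t).preimage (f := fun z : ℝ × ℝ => (κ z.1, z.2)) (by fun_prop))
    (fun t u => hG.ordConnected t _)
    (fun u => (hgm (κ u)).indicator measurableSet_Ioc)
    ((integrable_indicator_iff measurableSet_Ioc).2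
      ((intervalIntegrable_iff_integrableOn_Ioc_of_le hT.le).1 hm))
    (by
      filter_upwards [hmb] with t ht u
      by_cases htI : t ∈ Ioc 0 T
      · simpa [htI] using ht _ (hκ u) _ (hg t _)
      · simp [htI])
    (fun t ht u => by simpa [ht] using hg t (κ u)) x₀
  refine ⟨u, ⟨hu.1, ?_⟩, hu0⟩
  filter_upwards [hu.2] with t ht htI
  have hb := abs_le.1 ((hd.truncate hRr).abs_le hu htI)
  rw [hu0, ← hr] at hb
  have hid : κ (u t) = u t := by
    simp only [κ]
    rw [min_eq_right hb.2, max_eq_right hb.1]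
  simpa only [hid] using ht htI

end Existence

/-! ### Periodic extension -/

section Periodic

variable {T : ℝ} {G : ℝ → ℝ → Set ℝ} {u v : ℝ → ℝ}

lemma eq_of_periodic_of_eqOn (hT : 0 < T) (hu : Function.Periodic u T)
    (hv : Function.Periodic v T) (h : EqOn u v (Icc 0 T)) : u = v := by
  funext t
  have hmem := toIcoMod_mem_Ico hT 0 t
  rw [zero_add] at hmem
  rw [← hu.sub_zsmul_eq (toIcoDiv hT 0 t), ← hv.sub_zsmul_eq (toIcoDiv hT 0 t),
    self_sub_toIcoDiv_zsmul]
  exact h ⟨hmem.1, hmem.2.le⟩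

/-- A solution with equal values at `0` and `T` extends to a periodic solution. -/
lemma IsSolutionOn.exists_periodic_extension (hT : 0 < T) (hG : ∀ t u, G (t + T) u = G t u)
    (hu : IsSolutionOn G u (Icc 0 T)) (h : u T = u 0) :
    ∃ v, IsPeriodicSolution T G v ∧ EqOn v u (Icc 0 T) := by
  -- The derivative is extended periodically and then integrated. The primitive is periodic because
  -- `u T = u 0` makes the integral over a period vanish.
  let g : ℝ → ℝ := fun t => deriv u (toIcoMod hT 0 t)
  have hgper : Function.Periodic g T := fun t => by simp only [g, toIcoMod_add_right]
  have hac := hu.absolutelyContinuous hT.le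
  have hgeq {s : ℝ} (hs : s ∈ Ico 0 T) : g s = deriv u s := by
    simp only [g]
    rw [(toIcoMod_eq_self hT).2 (by simpa using hs)]
  have hneT : ∀ᵐ t : ℝ, t ≠ T := by simp [ae_iff, measure_singleton]
  have hg0 : IntervalIntegrable g volume 0 T := by
    refine hac.intervalIntegrable_deriv.congr_ae ?_
    rw [uIoc_of_le hT.le, EventuallyEq, ae_restrict_iff' measurableSet_Ioc]
    filter_upwards [hneT] with t ht htI
    exact (hgeq ⟨htI.1.le, lt_of_le_of_ne htI.2 ht⟩).symm
  have hgint (a b : ℝ) : IntervalIntegrable g volume a b :=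
    hgper.intervalIntegrable₀ hT.ne' hg0 a b
  have hgloc : LocallyIntegrable g volume := fun t => by
    refine ⟨Icc (t - 1) (t + 1), Icc_mem_nhds (by linarith) (by linarith), ?_⟩
    exact (intervalIntegrable_iff_integrableOn_Icc_of_le (by linarith)).1 (hgint _ _)
  let V : ℝ → ℝ := fun t => u 0 + ∫ s in (0 : ℝ)..t, g s
  have hVu : EqOn V u (Icc 0 T) := by
    intro t ht
    have hsub : uIcc 0 t ⊆ uIcc 0 T := by
      rw [uIcc_of_le ht.1, uIcc_of_le hT.le]
      exact Icc_subset_Icc_right ht.2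
    have h1 : ∫ s in (0 : ℝ)..t, g s = ∫ s in (0 : ℝ)..t, deriv u s := by
      refine intervalIntegral.integral_congr_ae ?_
      filter_upwards [hneT] with s hs hsI
      rw [uIoc_of_le ht.1] at hsI
      exact hgeq ⟨hsI.1.le, lt_of_le_of_ne (hsI.2.trans ht.2) hs⟩
    simp only [V]
    rw [h1, (hac.mono hsub).integral_deriv_eq_sub]
    ring
  have hVper : Function.Periodic V T := by
    intro t
    have h1 : ∫ s in t..t + T, g s = 0 := by
      rw [hgper.intervalIntegral_add_eq t 0, zero_add]
      have := hVu ⟨hT.le, le_rfl⟩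
      simp only [V] at this
      linarith
    have h2 := intervalIntegral.integral_add_adjacent_intervals (hgint 0 t) (hgint t (t + T))
    simp only [V]
    rw [← h2, h1, add_zero]
  refine ⟨V, ⟨hVper, fun a b _ _ => ?_, ?_⟩, hVu⟩
  · refine absolutelyContinuousOnInterval_of_dist_le ((hgint a b
      ).absolutelyContinuousOnInterval_intervalIntegral left_mem_uIcc) fun s _ t _ => ?_
    simp only [V, dist_add_left, Real.dist_eq]
    rw [intervalIntegral.integral_interval_sub_left (hgint _ _) (hgint _ _),
      intervalIntegral.integral_interval_sub_left (hgint _ _) (hgint _ _)]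
  -- The exceptional null set in `[0, T]` has countably many translates by multiples of `T`.
  · have hshift : ∀ᵐ t, ∀ k : ℤ, t - k • T ∈ Icc 0 T →
        deriv u (t - k • T) ∈ G (t - k • T) (u (t - k • T)) :=
      ae_all_iff.2 fun k =>
        (measurePreserving_sub_right volume (k • T)).quasiMeasurePreserving.ae hu.ae_deriv_mem
    filter_upwards [LocallyIntegrable.ae_hasDerivAt_integral hgloc, hshift] with t h1 h2 _
    refine ⟨g t, ?_, (h1 0).const_add (u 0)⟩
    have hmem := toIcoMod_mem_Ico hT 0 t
    rw [zero_add] at hmem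
    have hmem' : toIcoMod hT 0 t ∈ Icc 0 T := ⟨hmem.1, hmem.2.le⟩
    have h3 := h2 (toIcoDiv hT 0 t)
    have hGper : Function.Periodic G T := fun s => funext fun x => hG s x
    rw [hGper.sub_zsmul_eq, self_sub_toIcoDiv_zsmul] at h3
    have h4 : V t = u (toIcoMod hT 0 t) := by
      rw [← hVu hmem', ← self_sub_toIcoDiv_zsmul, hVper.sub_zsmul_eq]
    rw [h4]
    exact h3 hmem'

end Periodic

/-! ### The Poincaré map -/

section Poincare

variable {T R : ℝ} {G : ℝ → ℝ → Set ℝ} {lm lp Φ : ℝ → ℝ}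

lemma exists_isPoincareMap (hT : 0 < T) (hG : StructuralForm T G)
    (hd : Dissipative T G R lm lp) (hmono : ∀ t, MonotoneDecreasing (G t)) :
    ∃ Φ : ℝ → ℝ, IsPoincareMap T G Φ := by
  choose u hu hu0 using fun x₀ => exists_isSolutionOn hT hG hd x₀
  exact ⟨fun x₀ => u x₀ T, fun x₀ => ⟨u x₀, hu x₀, hu0 x₀, rfl, fun w hw hw0 =>
    hw.eqOn hmono (hu x₀) (hw0.trans (hu0 x₀).symm)⟩⟩

lemma IsPoincareMap.monotone (hΦ : IsPoincareMap T G Φ) (hT : 0 < T)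
    (hmono : ∀ t, MonotoneDecreasing (G t)) : Monotone Φ := by
  intro x y hxy
  obtain ⟨u, hu, hu0, huT, -⟩ := hΦ x
  obtain ⟨w, hw, hw0, hwT, -⟩ := hΦ y
  rw [← huT, ← hwT]
  exact hu.le_of_le hmono hw (by rwa [hu0, hw0]) ⟨hT.le, le_rfl⟩

lemma IsPoincareMap.abs_sub_le (hΦ : IsPoincareMap T G Φ) (hT : 0 < T)
    (hmono : ∀ t, MonotoneDecreasing (G t)) (x y : ℝ) : |Φ x - Φ y| ≤ |x - y| := by
  obtain ⟨u, hu, hu0, huT, -⟩ := hΦ x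
  obtain ⟨w, hw, hw0, hwT, -⟩ := hΦ y
  rw [← huT, ← hwT, ← hu0, ← hw0]
  exact hu.antitoneOn_abs_sub hmono hw ⟨le_rfl, hT.le⟩ ⟨hT.le, le_rfl⟩ hT.le

/-- The drop `-∫ lp` is positive and plays the role of `c` in `dynamics_of_absorbing`. -/
lemma IsPoincareMap.le_max (hΦ : IsPoincareMap T G Φ) (hT : 0 < T)
    (hd : Dissipative T G R lm lp) (x : ℝ) :
    Φ x ≤ max (vPlus T R lp) (x - -∫ s in (0 : ℝ)..T, lp s) := by
  obtain ⟨u, hu, hu0, huT, -⟩ := hΦ x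
  rw [← huT, ← hu0, le_max_iff, sub_neg_eq_add]
  exact hd.upper_bound hu ⟨hT.le, le_rfl⟩

lemma IsPoincareMap.min_le (hΦ : IsPoincareMap T G Φ) (hT : 0 < T)
    (hd : Dissipative T G R lm lp) (x : ℝ) :
    min (vMinus T R lm) (x + -∫ s in (0 : ℝ)..T, lm s) ≤ Φ x := by
  obtain ⟨u, hu, hu0, huT, -⟩ := hΦ x
  rw [← huT, ← hu0, min_le_iff, ← sub_eq_add_neg]
  exact hd.lower_bound hu ⟨hT.le, le_rfl⟩

lemma Dissipative.vMinus_le_vPlus (hd : Dissipative T G R lm lp) (hT : 0 < T) :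
    vMinus T R lm ≤ vPlus T R lp := by
  have hI (l : ℝ → ℝ) : 0 ≤ ∫ s in (0 : ℝ)..T, |l s| :=
    intervalIntegral.integral_nonneg hT.le fun s _ => abs_nonneg _
  have := hd.R_pos
  have := hI lm
  have := hI lp
  unfold vMinus vPlus
  linarith

variable {v w : ℝ → ℝ}

lemma IsPeriodicSolution.isSolutionOn_Icc (hv : IsPeriodicSolution T G v) (a b : ℝ) :
    IsSolutionOn G v (Icc a b) :=
  hv.2.mono (subset_univ _)

lemma IsPeriodicSolution.map_zero (hv : IsPeriodicSolution T G v) (hΦ : IsPoincareMap T G Φ)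
    (hT : 0 < T) : Φ (v 0) = v 0 := by
  obtain ⟨u, hu, hu0, huT, huniq⟩ := hΦ (v 0)
  rw [← huT, ← huniq v (hv.isSolutionOn_Icc 0 T) rfl ⟨hT.le, le_rfl⟩]
  simpa using hv.1 0

lemma IsPeriodicSolution.eq_of_zero (hv : IsPeriodicSolution T G v)
    (hw : IsPeriodicSolution T G w) (hT : 0 < T) (hmono : ∀ t, MonotoneDecreasing (G t))
    (h : v 0 = w 0) : v = w :=
  eq_of_periodic_of_eqOn hT hv.1 hw.1
    ((hv.isSolutionOn_Icc 0 T).eqOn hmono (hw.isSolutionOn_Icc 0 T) h)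

/-- Two periodic solutions differ by a constant. -/
lemma IsPeriodicSolution.eq_add_const (hv : IsPeriodicSolution T G v)
    (hw : IsPeriodicSolution T G w) (hT : 0 < T) (hmono : ∀ t, MonotoneDecreasing (G t))
    (h : w 0 ≤ v 0) : v = fun t => w t + (v 0 - w 0) := by
  refine eq_of_periodic_of_eqOn hT hv.1 (fun t => by simp only [hw.1 t]) fun t ht => ?_
  have hv' := hv.isSolutionOn_Icc 0 T
  have hw' := hw.isSolutionOn_Icc 0 T
  have hanti := hv'.antitoneOn_abs_sub hmono hw'
  -- The distance at `t` is squeezed between its equal values at `0` and `T`; preservation of order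
  -- then removes the absolute value.
  have h1 := hanti ⟨le_rfl, hT.le⟩ ht ht.1
  have h2 := hanti ht ⟨hT.le, le_rfl⟩ ht.2
  have hvT : v T = v 0 := by simpa using hv.1 0
  have hwT : w T = w 0 := by simpa using hw.1 0
  simp only [hvT, hwT] at h1 h2
  rw [abs_of_nonneg (sub_nonneg.2 h),
    abs_of_nonneg (sub_nonneg.2 (hw'.le_of_le hmono hv' h ht))] at h1 h2
  linarith

lemma IsPoincareMap.exists_isPeriodicSolution (hΦ : IsPoincareMap T G Φ) (hT : 0 < T)
    (hG : StructuralForm T G) {γ : ℝ} (hγ : Φ γ = γ) :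
    ∃ v, IsPeriodicSolution T G v ∧ v 0 = γ := by
  obtain ⟨u, hu, hu0, huT, -⟩ := hΦ γ
  obtain ⟨v, hv, hvu⟩ := hu.exists_periodic_extension hT hG.periodic (by rw [huT, hγ, hu0])
  exact ⟨v, hv, (hvu ⟨le_rfl, hT.le⟩).trans hu0⟩

end Poincare

end PeriodicInclusion

open PeriodicInclusion
theorem mainTheorem8 (T : ℝ) (hT : 0 < T) (G : ℝ → ℝ → Set ℝ)
    (hS1 : StructuralForm T G)
    (R : ℝ) (lm lp : ℝ → ℝ) (hS2 : Dissipative T G R lm lp)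
    (hmono : ∀ t, MonotoneDecreasing (G t)) :
    ∃ Φ : ℝ → ℝ, IsPoincareMap T G Φ ∧
    ∃ α β : ℝ, α ≤ β ∧
      -- the set K is the compact interval [α, β], a global attractor consisting of fixed points
      attractorSet Φ T R lm lp = Set.Icc α β ∧
      IsGlobalAttractor Φ (attractorSet Φ T R lm lp) ∧
      Φ α = α ∧ Φ β = β ∧
      (∀ v₀ : ℝ, ∃ vlim ∈ Set.Icc α β, Φ vlim = vlim ∧
        Filter.Tendsto (fun i : ℕ => Φ^[i] v₀) Filter.atTop (nhds vlim)) ∧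
      attractorSet Φ T R lm lp = {x | Φ x = x} ∧
      (∀ γ ∈ attractorSet Φ T R lm lp, ∃! v : ℝ → ℝ, IsPeriodicSolution T G v ∧ v 0 = γ) ∧
      -- the periodic solutions are exactly the vertical translates of the one through α
      ∃ vα : ℝ → ℝ, IsPeriodicSolution T G vα ∧ vα 0 = α ∧
        ∀ v : ℝ → ℝ, IsPeriodicSolution T G v ↔
          ∃ γ ∈ Set.Icc α β, v = fun t => vα t + (γ - α) := by
  obtain ⟨Φ, hΦ⟩ := exists_isPoincareMap hT hS1 hS2 hmono
  obtain ⟨α, β, hαβ, hK, hattr, hα, hβ, hlim, hfix⟩ :=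
    dynamics_of_absorbing (hΦ.monotone hT hmono) (hΦ.abs_sub_le hT hmono)
      (hS2.vMinus_le_vPlus hT) (neg_pos.2 hS2.lp_neg) (neg_pos.2 hS2.lm_neg)
      (hΦ.le_max hT hS2) (hΦ.min_le hT hS2)
  have hK' : attractorSet Φ T R lm lp = Set.Icc α β := hK
  have hmem {x : ℝ} : x ∈ Set.Icc α β ↔ Φ x = x := by rw [hfix]; rfl
  obtain ⟨vα, hvα, hvα0⟩ := hΦ.exists_isPeriodicSolution hT hS1 hα
  have htrans (v : ℝ → ℝ) (hv : IsPeriodicSolution T G v) :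
      v 0 ∈ Set.Icc α β ∧ v = fun t => vα t + (v 0 - α) := by
    have h0 := hmem.2 (hv.map_zero hΦ hT)
    have h1 := hv.eq_add_const hvα hT hmono (hvα0.trans_le h0.1)
    rw [hvα0] at h1
    exact ⟨h0, h1⟩
  refine ⟨Φ, hΦ, α, β, hαβ, hK', hK' ▸ hattr, hα, hβ, hlim, hK'.trans hfix, fun γ hγ => ?_,
    vα, hvα, hvα0, fun v => ⟨fun hv => ⟨v 0, htrans v hv⟩, ?_⟩⟩
  · rw [hK', hmem] at hγ
    obtain ⟨v, hv, hv0⟩ := hΦ.exists_isPeriodicSolution hT hS1 hγ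
    exact ⟨v, ⟨hv, hv0⟩, fun w hw => hw.1.eq_of_zero hv hT hmono (hw.2.trans hv0.symm)⟩
  -- The translate is a solution because it coincides with the periodic solution through the fixed
  -- point `γ`.
  · rintro ⟨γ, hγ, rfl⟩
    obtain ⟨w, hw, hw0⟩ := hΦ.exists_isPeriodicSolution hT hS1 (hmem.1 hγ)
    have h1 := (htrans w hw).2
    rw [hw0] at h1
    rwa [← h1]
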